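/- Let $\Gamma$ be a simple graph with (possibly infinite) vertex set $V(\Gamma)$, and let $$G(\Gamma) = \langle\, V(\Gamma) \mid ab = ba \text{ for all adjacent } a, b \in V(\Gamma) \,\rangle$$ be the associated graph group (right-angled Artin group). Suppose that $\Gamma$ has no induced subgraph isomorphic to the four-cycle $C_4$. Then: (1) $G(\Gamma)$ has no subgroup isomorphic to a direct product $\prod_{i \in I} H_i$ of two or more groups (that is, $|I| \ge 2$, where $I$ may be infinite), each of which is non-abelian; (2) $G(\Gamma)$ has no submonoid isomorphic to a direct product $\prod_{i \in I} M_i$ of two or more monoids (that is, $|I| \ge 2$, where $I$ may be infinite), each of which is non-abelian (i.e. non-commutative). -/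

import Mathlib

universe u v w

/-- The commutators `(a b) (b a)⁻¹` of adjacent vertices of `Γ`, in the free group on the vertices;
killing them imposes exactly the relations `a b = b a` for adjacent `a` and `b`. -/
def graphGroupRels {V : Type u} (Γ : SimpleGraph V) : Set (FreeGroup V) :=
  {r | ∃ a b : V, Γ.Adj a b ∧ r = (FreeGroup.of a * FreeGroup.of b) * (FreeGroup.of b * FreeGroup.of a)⁻¹}

/-- The graph group (right-angled Artin group) `G(Γ) = ⟨V(Γ) ∣ ab = ba for adjacent a, b⟩`.
Loops at vertices would only add the trivial relations `aa = aa`, so `Γ` is a simple graph. -/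
abbrev GraphGroup {V : Type u} (Γ : SimpleGraph V) : Type u :=
  PresentedGroup (graphGroupRels Γ)

/-- A monoid (in particular, a group) is non-abelian if two of its elements do not commute. -/
def IsNonAbelian (M : Type v) [Monoid M] : Prop :=
  ∃ a b : M, a * b ≠ b * a

/-! Two noncommuting elements in each of two factors give `a, b, c, d` in which neither `a, b` nor
`c, d` commute, but every cross pair does. Only these relations matter, so groups and monoids are
handled alike, and `isIndContained_of_commute` produces the four-cycle.

Killing a vertex `v` has a free kernel, generated by conjugates of `v` that are indexed by cosets of
the link of `v` (`split`). If `f ≠ 1` lies in this kernel and `c` commutes with `f`, then `kill Γ v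
c` permutes the cosets and preserves the conjugacy class of `f`, so some power fixes a coset
relevant to `f`. Uniqueness of roots (`eq_of_pow_eq`) removes the power. Hence
(`exists_hom_centralizer`) the centralizer of `f` maps to a free group with `f` surviving, and its
image under `kill Γ v` is conjugate into the link.

The first half shows that no vertex makes both pairs commute when killed (`not_commute_kill`). With
the support `S` minimal, each vertex of `S` makes exactly one pair commute. The second half then
forces a join structure on the vertices, from which the four-cycle is read off
(`isIndContained_of_not_commute_kill`). -/

/-! ### Free groups: centralizers and permutations of the generators -/

namespace FreeGroup

variable {X : Type u}

/-- A free group with nontrivial centre has at most one free generator. -/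
theorem subsingleton_of_central_ne_one {z : FreeGroup X} (hz : z ≠ 1)
    (hc : ∀ x, Commute x z) : Subsingleton X := by
  classical
  by_contra hX
  rw [not_subsingleton_iff_nontrivial] at hX
  rcases hw : z.toWord with _ | ⟨⟨a, e⟩, l⟩
  · exact hz (toWord_eq_nil_iff.1 hw)
  obtain ⟨y, hy⟩ := exists_ne a
  have hred : IsReduced ((y, true) :: (a, e) :: l) := by
    rw [isReduced_cons_cons]
    refine ⟨fun h => absurd h hy, ?_⟩
    rw [← hw]
    exact isReduced_toWord
  have h1 : (of y * z).toWord = (y, true) :: (a, e) :: l := by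
    have : of y * z = mk ((y, true) :: (a, e) :: l) := by
      conv_lhs => rw [← mk_toWord (x := z), hw]
      rfl
    rw [this, toWord_mk, hred.reduce_eq]
  have h2 : (z * of y).toWord = reduce ((a, e) :: l ++ [(y, true)]) := by
    rw [toWord_mul, hw, toWord_of]
  rw [← (hc (of y)).eq, h1] at h2
  -- The two words have equal length, so the reduction cancels nothing and the first letters `y` and
  -- `a` would agree.
  have hs : ((y, true) :: (a, e) :: l) = (a, e) :: l ++ [(y, true)] := by
    have hr : Red ((a, e) :: l ++ [(y, true)]) ((y, true) :: (a, e) :: l) := by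
      rw [h2]; exact reduce.red
    exact ((Red.sublist hr).eq_of_length (by simp))
  simp only [List.cons_append, List.cons.injEq, Prod.mk.injEq] at hs
  exact hy hs.1.1

theorem isCyclic_of_subsingleton [Subsingleton X] : IsCyclic (FreeGroup X) := by
  rcases isEmpty_or_nonempty X with h | ⟨⟨x⟩⟩
  · infer_instance
  · refine ⟨of x, fun g => ?_⟩
    change g ∈ Subgroup.zpowers (of x)
    induction g using FreeGroup.induction_on with
    | C1 => exact one_mem _
    | of y => rw [Subsingleton.elim y x]; exact Subgroup.mem_zpowers _
    | inv_of y h => exact inv_mem h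
    | mul a b ha hb => exact mul_mem ha hb

/-- Centralizers of nontrivial elements of a free group are cyclic. -/
theorem exists_forall_commute_mem_zpowers {z : FreeGroup X} (hz : z ≠ 1) :
    ∃ r : FreeGroup X, ∀ x, Commute x z → x ∈ Subgroup.zpowers r := by
  let H := Subgroup.centralizer {z}
  have hzH : z ∈ H := Subgroup.mem_centralizer_singleton_iff.2 rfl
  -- By Nielsen–Schreier the centralizer is itself free, and `z` is central in it.
  let e := IsFreeGroup.toFreeGroup H
  have hs : Subsingleton (IsFreeGroup.Generators H) := by
    refine subsingleton_of_central_ne_one (z := e ⟨z, hzH⟩) ?_ fun x => ?_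
    · rw [Ne, map_eq_one_iff e e.injective]
      exact fun h => hz (congrArg Subtype.val h)
    · obtain ⟨x, rfl⟩ := e.surjective x
      refine Commute.map (Subtype.ext ?_) e
      exact (Subgroup.mem_centralizer_singleton_iff.1 x.2)
  have hc := isCyclic_of_subsingleton (X := IsFreeGroup.Generators H)
  obtain ⟨r, hr⟩ := (e.isCyclic.2 hc)
  refine ⟨r, fun x hx => ?_⟩
  obtain ⟨n, hn⟩ := hr ⟨x, Subgroup.mem_centralizer_singleton_iff.2 hx.eq⟩
  exact ⟨n, by simpa using congrArg Subtype.val hn⟩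

/-- Commuting with a nontrivial element is transitive in a free group. -/
theorem commute_of_commute {x y z : FreeGroup X} (hz : z ≠ 1) (hx : Commute x z)
    (hy : Commute y z) : Commute x y := by
  obtain ⟨r, hr⟩ := exists_forall_commute_mem_zpowers hz
  obtain ⟨m, rfl⟩ := hr x hx
  obtain ⟨n, rfl⟩ := hr y hy
  exact Commute.zpow_zpow_self r m n

/-- Nontrivial commuting elements of a free group have a common nontrivial power. -/
theorem exists_zpow_eq_zpow_of_commute {x y : FreeGroup X} (hx : x ≠ 1) (hy : y ≠ 1)
    (h : Commute x y) : ∃ m n : ℤ, m ≠ 0 ∧ n ≠ 0 ∧ x ^ m = y ^ n := by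
  obtain ⟨r, hr⟩ := exists_forall_commute_mem_zpowers hy
  obtain ⟨m, rfl⟩ := hr x h
  obtain ⟨n, rfl⟩ := hr y (Commute.refl y)
  refine ⟨n, m, ?_, ?_, ?_⟩
  · rintro rfl; simp at hy
  · rintro rfl; simp at hx
  · simp only [← zpow_mul, mul_comm]

open Classical in
/-- The endomorphism of a free group that kills the generators outside `Y`. -/
noncomputable def restrictTo (Y : Set X) : FreeGroup X →* FreeGroup X :=
  lift fun x => if x ∈ Y then of x else 1

theorem restrictTo_of_mem {Y : Set X} {x : X} (h : x ∈ Y) : restrictTo Y (of x) = of x := by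
  simp [restrictTo, h]

theorem restrictTo_of_notMem {Y : Set X} {x : X} (h : x ∉ Y) : restrictTo Y (of x) = 1 := by
  simp [restrictTo, h]

theorem restrictTo_restrictTo (Y Z : Set X) (f : FreeGroup X) :
    restrictTo Y (restrictTo Z f) = restrictTo (Y ∩ Z) f := by
  suffices (restrictTo Y).comp (restrictTo Z) = restrictTo (Y ∩ Z) from DFunLike.congr_fun this f
  ext x
  by_cases hY : x ∈ Y <;> by_cases hZ : x ∈ Z <;>
    simp [restrictTo, hY, hZ]

theorem exists_finset_restrictTo_eq (f : FreeGroup X) :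
    ∃ Z : Finset X, restrictTo (Z : Set X) f = f := by
  classical
  have mono : ∀ (Z W : Finset X) (g : FreeGroup X), Z ⊆ W → restrictTo (Z : Set X) g = g →
      restrictTo (W : Set X) g = g := fun Z W g h hg => by
    rw [← hg, restrictTo_restrictTo, Set.inter_eq_right.2 (Finset.coe_subset.2 h)]
  induction f using FreeGroup.induction_on with
  | C1 => exact ⟨∅, _root_.map_one _⟩
  | of x => exact ⟨{x}, restrictTo_of_mem (by simp)⟩
  | inv_of x h => obtain ⟨Z, hZ⟩ := h; exact ⟨Z, by rw [_root_.map_inv, hZ]⟩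
  | mul a b ha hb =>
    obtain ⟨Z, hZ⟩ := ha
    obtain ⟨W, hW⟩ := hb
    exact ⟨Z ∪ W, by rw [_root_.map_mul, mono Z _ a Finset.subset_union_left hZ,
      mono W _ b Finset.subset_union_right hW]⟩

theorem restrictTo_image_freeGroupCongr (σ : Equiv.Perm X) (Y : Set X) (f : FreeGroup X) :
    restrictTo (σ '' Y) (freeGroupCongr σ f) = freeGroupCongr σ (restrictTo Y f) := by
  suffices (restrictTo (σ '' Y)).comp (freeGroupCongr σ).toMonoidHom =
      (freeGroupCongr σ).toMonoidHom.comp (restrictTo Y) from DFunLike.congr_fun this f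
  ext x
  by_cases hY : x ∈ Y <;> simp [restrictTo, hY]

theorem restrictTo_ne_one_of_isConj {Y : Set X} {f g : FreeGroup X} (h : IsConj f g)
    (hf : restrictTo Y f ≠ 1) : restrictTo Y g ≠ 1 := by
  have := (restrictTo Y).map_isConj h
  intro h1
  rw [h1, isConj_one_left] at this
  exact hf this

/-- A nontrivial element of a free group remains nontrivial after restriction to some finite set of
generators, each of which is periodic for every permutation that preserves the conjugacy class. -/
theorem exists_periodic_finset {f : FreeGroup X} (hf : f ≠ 1) :
    ∃ Y : Finset X, restrictTo (Y : Set X) f ≠ 1 ∧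
      ∀ σ : Equiv.Perm X, IsConj (freeGroupCongr σ f) f → ∀ y ∈ Y, ∃ N > 0, (σ ^ N) y = y := by
  classical
  obtain ⟨Z, hZ⟩ := exists_finset_restrictTo_eq f
  have hex : ∃ n, ∃ Y : Finset X, Y.card = n ∧ restrictTo (Y : Set X) f ≠ 1 :=
    ⟨_, Z, rfl, by rwa [hZ]⟩
  obtain ⟨Y, hYc, hY⟩ := Nat.find_spec hex
  -- `Y` has least cardinality among the sets that detect `f`. Since `W ∩ Z` detects `f` whenever
  -- `W` does, a detecting set of that size lies in the finite support `Z`. The translates of `Y`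
  -- under `σ` are such sets, so orbits of points of `Y` stay in `Z`.
  have key : ∀ W : Finset X, W.card = Y.card → restrictTo (W : Set X) f ≠ 1 → W ⊆ Z := by
    intro W hW h1
    rw [← hZ, restrictTo_restrictTo, ← Finset.coe_inter] at h1
    have := Nat.find_min' hex ⟨_, rfl, h1⟩
    rw [← hYc, ← hW] at this
    exact Finset.inter_eq_left.1 (Finset.eq_of_subset_of_card_le Finset.inter_subset_left this)
  refine ⟨Y, hY, fun σ hσ y hy => ?_⟩
  have hiter : ∀ j : ℕ, ∃ W : Finset X, W.card = Y.card ∧ restrictTo (W : Set X) f ≠ 1 ∧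
      (σ ^ j) y ∈ W := by
    intro j
    induction j with
    | zero => exact ⟨Y, rfl, hY, hy⟩
    | succ j ih =>
      obtain ⟨W, hWc, hW, hj⟩ := ih
      refine ⟨W.map σ.toEmbedding, by simpa using hWc, ?_, ?_⟩
      · refine restrictTo_ne_one_of_isConj hσ ?_
        rw [Finset.coe_map]
        exact (restrictTo_image_freeGroupCongr σ W f).symm ▸
          fun h => hW ((map_eq_one_iff _ (freeGroupCongr σ).injective).1 h)
      · rw [pow_succ']
        exact Finset.mem_map_of_mem _ hj
  have hmem : ∀ j : ℕ, (σ ^ j) y ∈ Z := fun j => by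
    obtain ⟨W, h1, h2, h3⟩ := hiter j
    exact key W h1 h2 h3
  obtain ⟨i, j, hij, h⟩ := Finite.exists_ne_map_eq_of_infinite
    (fun j : ℕ => (⟨(σ ^ j) y, hmem j⟩ : Z))
  have main : ∀ i j : ℕ, i < j → (σ ^ i) y = (σ ^ j) y → ∃ N > 0, (σ ^ N) y = y := by
    intro i j hlt h
    refine ⟨j - i, Nat.sub_pos_of_lt hlt, ?_⟩
    apply (σ ^ i).injective
    rw [← Equiv.Perm.mul_apply, ← pow_add, Nat.add_sub_cancel' hlt.le, h]
  have h' := congrArg Subtype.val h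
  rcases lt_or_gt_of_ne hij with hlt | hlt
  · exact main i j hlt h'
  · exact main j i hlt h'.symm

/-- The action of a group on a free group by permuting the free generators. -/
def permAut (G : Type v) [Group G] (X : Type u) [MulAction G X] : G →* MulAut (FreeGroup X) where
  toFun g := freeGroupCongr (MulAction.toPerm g)
  map_one' := by
    apply MulEquiv.toMonoidHom_injective
    ext x
    simp
  map_mul' g h := by
    apply MulEquiv.toMonoidHom_injective
    ext x
    simp [mul_smul]

theorem permAut_of {G : Type v} [Group G] [MulAction G X] (g : G) (x : X) :
    permAut G X g (of x) = of (g • x) := by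
  simp [permAut]

/-- Fixing `Y` pointwise also preserves its complement. This makes `cosetHom` multiplicative: the
twist in the semidirect product disappears after restriction. -/
theorem restrictTo_permAut {G : Type v} [Group G] [MulAction G X] {Y : Set X} {g : G}
    (hg : g ∈ fixingSubgroup G Y) (f : FreeGroup X) :
    restrictTo Y (permAut G X g f) = restrictTo Y f := by
  suffices (restrictTo Y).comp (permAut G X g).toMonoidHom = restrictTo Y from
    DFunLike.congr_fun this f
  rw [mem_fixingSubgroup_iff] at hg
  ext x
  by_cases hx : x ∈ Y
  · simp [permAut_of, hg x hx]
  · have : g • x ∉ Y := fun h => hx (by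
      have h2 := hg _ h
      rw [smul_left_cancel_iff] at h2
      rwa [h2] at h)
    simp [permAut_of, restrictTo_of_notMem hx, restrictTo_of_notMem this]

end FreeGroup

/-! ### Graph groups: retractions and the splitting along a vertex -/

namespace GraphGroup

open SemidirectProduct FreeGroup

variable {V : Type u} {Γ : SimpleGraph V}

/-- The generator of the graph group given by a vertex. -/
def of (Γ : SimpleGraph V) (a : V) : GraphGroup Γ := PresentedGroup.of a

theorem of_commute {a b : V} (h : Γ.Adj a b) : Commute (of Γ a) (of Γ b) :=
  PresentedGroup.mk_eq_mk_of_mul_inv_mem ⟨a, b, h, rfl⟩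

/-- The homomorphism out of a graph group determined by images of vertices that commute whenever
the vertices are adjacent. -/
def lift {H : Type v} [Group H] (f : V → H) (hf : ∀ a b, Γ.Adj a b → Commute (f a) (f b)) :
    GraphGroup Γ →* H :=
  PresentedGroup.toGroup (f := f) (by
    rintro _ ⟨a, b, hab, rfl⟩
    simp [(hf a b hab).eq])

@[simp]
theorem lift_of {H : Type v} [Group H] (f : V → H) (hf : ∀ a b, Γ.Adj a b → Commute (f a) (f b))
    (a : V) : lift f hf (of Γ a) = f a :=
  PresentedGroup.toGroup.of _

theorem hom_ext {H : Type v} [Group H] {f g : GraphGroup Γ →* H}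
    (h : ∀ a, f (of Γ a) = g (of Γ a)) : f = g :=
  PresentedGroup.ext h

theorem induction {p : GraphGroup Γ → Prop} (one : p 1) (gen : ∀ a, p (of Γ a))
    (mul : ∀ x y, p x → p y → p (x * y)) (inv : ∀ x, p x → p x⁻¹) (g : GraphGroup Γ) : p g := by
  have : g ∈ Subgroup.closure (Set.range (PresentedGroup.of (rels := graphGroupRels Γ))) := by
    rw [PresentedGroup.closure_range_of]; trivial
  induction this using Subgroup.closure_induction with
  | mem x hx => obtain ⟨a, rfl⟩ := hx; exact gen a
  | one => exact one
  | mul x y _ _ hx hy => exact mul x y hx hy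
  | inv x _ hx => exact inv x hx

open Classical in
/-- The retraction of a graph group that kills the vertices outside `S`. -/
noncomputable def retract (Γ : SimpleGraph V) (S : Set V) : GraphGroup Γ →* GraphGroup Γ :=
  lift (fun a => if a ∈ S then of Γ a else 1) fun a b h => by
    split_ifs
    · exact of_commute h
    all_goals simp

theorem retract_of_mem {S : Set V} {a : V} (h : a ∈ S) : retract Γ S (of Γ a) = of Γ a := by
  simp [retract, h]

theorem retract_of_notMem {S : Set V} {a : V} (h : a ∉ S) : retract Γ S (of Γ a) = 1 := by
  simp [retract, h]

theorem retract_retract (S T : Set V) (g : GraphGroup Γ) :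
    retract Γ S (retract Γ T g) = retract Γ (S ∩ T) g := by
  suffices (retract Γ S).comp (retract Γ T) = retract Γ (S ∩ T) from DFunLike.congr_fun this g
  refine hom_ext fun a => ?_
  by_cases hS : a ∈ S <;> by_cases hT : a ∈ T <;>
    simp [retract, hS, hT]

theorem retract_comm (S T : Set V) (g : GraphGroup Γ) :
    retract Γ S (retract Γ T g) = retract Γ T (retract Γ S g) := by
  rw [retract_retract, retract_retract, Set.inter_comm]

theorem retract_empty (g : GraphGroup Γ) : retract Γ ∅ g = 1 := by
  suffices retract Γ ∅ = 1 from DFunLike.congr_fun this g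
  exact hom_ext fun a => retract_of_notMem (Set.notMem_empty a)

theorem retract_eq_of_subset {S T : Set V} (h : S ⊆ T) {g : GraphGroup Γ}
    (hg : retract Γ S g = g) : retract Γ T g = g := by
  rw [← hg, retract_retract, Set.inter_eq_right.2 h]

/-- Every element of a graph group is supported on finitely many vertices. -/
theorem exists_finset_retract_eq (g : GraphGroup Γ) :
    ∃ S : Finset V, retract Γ (S : Set V) g = g := by
  classical
  induction g using GraphGroup.induction with
  | one => exact ⟨∅, _root_.map_one _⟩
  | gen a => exact ⟨{a}, retract_of_mem (by simp)⟩
  | inv x h => obtain ⟨S, hS⟩ := h; exact ⟨S, by rw [_root_.map_inv, hS]⟩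
  | mul x y hx hy =>
    obtain ⟨S, hS⟩ := hx
    obtain ⟨T, hT⟩ := hy
    refine ⟨S ∪ T, ?_⟩
    rw [_root_.map_mul,
      retract_eq_of_subset (Finset.coe_subset.2 Finset.subset_union_left) hS,
      retract_eq_of_subset (Finset.coe_subset.2 Finset.subset_union_right) hT]

theorem commute_of_forall_mem {S : Set V} {g : GraphGroup Γ}
    (h : ∀ a ∈ S, Commute g (of Γ a)) (x : GraphGroup Γ) : Commute g (retract Γ S x) := by
  induction x using GraphGroup.induction with
  | one => simp
  | gen a =>
    by_cases ha : a ∈ S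
    · rw [retract_of_mem ha]; exact h a ha
    · simp [retract_of_notMem ha]
  | inv x h => rw [_root_.map_inv]; exact h.inv_right
  | mul x y hx hy => rw [_root_.map_mul]; exact hx.mul_right hy

/-- The retraction killing a single vertex. -/
noncomputable abbrev kill (Γ : SimpleGraph V) (v : V) : GraphGroup Γ →* GraphGroup Γ :=
  retract Γ {v}ᶜ

/-- The subgroup generated by the neighbours of a vertex. -/
noncomputable abbrev link (Γ : SimpleGraph V) (v : V) : Subgroup (GraphGroup Γ) :=
  (retract Γ (Γ.neighborSet v)).range

theorem mem_link_iff {v : V} {g : GraphGroup Γ} :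
    g ∈ link Γ v ↔ retract Γ (Γ.neighborSet v) g = g := by
  constructor
  · rintro ⟨x, rfl⟩
    rw [retract_retract, Set.inter_self]
  · exact fun h => ⟨g, h⟩

theorem commute_link {v : V} {g : GraphGroup Γ} (hg : g ∈ link Γ v) : Commute (of Γ v) g := by
  obtain ⟨x, rfl⟩ := hg
  exact commute_of_forall_mem (fun a ha => of_commute ha) x

theorem kill_mem_link {v : V} {g : GraphGroup Γ} (hg : g ∈ link Γ v) : kill Γ v g ∈ link Γ v := by
  obtain ⟨x, rfl⟩ := hg
  exact ⟨kill Γ v x, retract_comm _ _ _⟩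

/-- The free group on the cosets of the link of `v`, which describes the kernel of `kill Γ v`. -/
abbrev CosetFreeGroup (Γ : SimpleGraph V) (v : V) : Type u := FreeGroup (GraphGroup Γ ⧸ link Γ v)

/-- The action on the free group on the cosets of the link of `v`. -/
noncomputable abbrev cosetAut (Γ : SimpleGraph V) (v : V) :
    GraphGroup Γ →* MulAut (CosetFreeGroup Γ v) :=
  permAut (GraphGroup Γ) (GraphGroup Γ ⧸ link Γ v)

open Classical in
/-- The decomposition of a graph group along the vertex `v` as a subgroup of a semidirect product
of a free group. -/
noncomputable def split (Γ : SimpleGraph V) (v : V) :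
    GraphGroup Γ →* CosetFreeGroup Γ v ⋊[cosetAut Γ v] GraphGroup Γ :=
  lift (fun a => if a = v then inl (.of ((1 : GraphGroup Γ) : GraphGroup Γ ⧸ link Γ v))
    else inr (of Γ a)) (by
    have key : ∀ b, Γ.Adj v b → Commute
        (inl (.of ((1 : GraphGroup Γ) : GraphGroup Γ ⧸ link Γ v)) :
          CosetFreeGroup Γ v ⋊[cosetAut Γ v] GraphGroup Γ) (inr (of Γ b)) := by
      intro b hb
      have hfix : of Γ b • ((1 : GraphGroup Γ) : GraphGroup Γ ⧸ link Γ v) =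
          ((1 : GraphGroup Γ) : GraphGroup Γ ⧸ link Γ v) := by
        rw [MulAction.Quotient.smul_coe, eq_comm, QuotientGroup.eq]
        simpa using mem_link_iff.2 (retract_of_mem hb)
      refine SemidirectProduct.ext ?_ ?_
      · simp [permAut_of, hfix]
      · simp
    intro a b hab
    by_cases ha : a = v <;> by_cases hb : b = v
    · simp [ha, hb]
    · subst ha; simpa [hb] using key b hab
    · subst hb; simpa [ha] using (key a hab.symm).symm
    · simpa [ha, hb] using (of_commute hab).map _)

theorem split_of_self (v : V) :
    split Γ v (of Γ v) = inl (.of ((1 : GraphGroup Γ) : GraphGroup Γ ⧸ link Γ v)) := by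
  simp [split]

theorem split_of_ne {v a : V} (h : a ≠ v) : split Γ v (of Γ a) = inr (of Γ a) := by
  simp [split, h]

theorem split_right (v : V) (g : GraphGroup Γ) : (split Γ v g).right = kill Γ v g := by
  suffices rightHom.comp (split Γ v) = kill Γ v from DFunLike.congr_fun this g
  refine hom_ext fun a => ?_
  by_cases h : a = v
  · subst h
    simp [split_of_self, kill, retract_of_notMem]
  · simp [split_of_ne h, kill, retract_of_mem, h]

/-- The conjugate of `v` attached to a coset of its link. -/
noncomputable def cosetConj (Γ : SimpleGraph V) (v : V) :
    GraphGroup Γ ⧸ link Γ v → GraphGroup Γ :=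
  Quotient.lift (fun g => kill Γ v g * of Γ v * (kill Γ v g)⁻¹) fun g h hgh => by
    have hl : g⁻¹ * h ∈ link Γ v := QuotientGroup.leftRel_apply.1 hgh
    have hc := (commute_link (kill_mem_link hl)).eq
    have : kill Γ v h = kill Γ v g * kill Γ v (g⁻¹ * h) := by simp
    change kill Γ v g * of Γ v * (kill Γ v g)⁻¹ = kill Γ v h * of Γ v * (kill Γ v h)⁻¹
    rw [this, mul_inv_rev, mul_assoc (kill Γ v g) _ (of Γ v), ← hc]
    group

theorem cosetConj_mk (v : V) (g : GraphGroup Γ) :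
    cosetConj Γ v (g : GraphGroup Γ ⧸ link Γ v) = kill Γ v g * of Γ v * (kill Γ v g)⁻¹ := rfl

/-- A left inverse of `split Γ v`. -/
noncomputable def unsplit (Γ : SimpleGraph V) (v : V) :
    CosetFreeGroup Γ v ⋊[cosetAut Γ v] GraphGroup Γ →* GraphGroup Γ :=
  SemidirectProduct.lift (FreeGroup.lift (cosetConj Γ v)) (kill Γ v) fun g => by
    ext x
    induction x using QuotientGroup.induction_on with
    | H k => simp [permAut_of, cosetConj_mk, mul_assoc]

theorem unsplit_split (v : V) (g : GraphGroup Γ) : unsplit Γ v (split Γ v g) = g := by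
  suffices (unsplit Γ v).comp (split Γ v) = MonoidHom.id _ from DFunLike.congr_fun this g
  refine hom_ext fun a => ?_
  by_cases h : a = v
  · subst h
    simp [split_of_self, unsplit, cosetConj_mk]
  · simp [split_of_ne h, unsplit, kill, retract_of_mem, h]

theorem split_injective (v : V) : Function.Injective (split Γ v) :=
  Function.LeftInverse.injective (unsplit_split v)

theorem split_eq_inl {v : V} {f : GraphGroup Γ} (hf : kill Γ v f = 1) :
    split Γ v f = inl (split Γ v f).left := by
  refine SemidirectProduct.ext rfl ?_
  rw [split_right, hf, right_inl]

theorem split_left_ne_one {v : V} {f : GraphGroup Γ} (hf : kill Γ v f = 1) (hf1 : f ≠ 1) :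
    (split Γ v f).left ≠ 1 := by
  intro h
  have := split_eq_inl hf
  rw [h, _root_.map_one, map_eq_one_iff _ (split_injective v)] at this
  exact hf1 this

/-- The homomorphism to a free group given by the cosets in `Y`, on the elements that fix them. -/
noncomputable def cosetHom (Γ : SimpleGraph V) (v : V) (Y : Set (GraphGroup Γ ⧸ link Γ v)) :
    (fixingSubgroup (GraphGroup Γ) Y).comap (kill Γ v) →* CosetFreeGroup Γ v where
  toFun c := restrictTo Y (split Γ v c).left
  map_one' := by simp
  map_mul' c d := by
    have hc : kill Γ v c ∈ fixingSubgroup (GraphGroup Γ) Y := c.2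
    simp [split_right, restrictTo_permAut hc]

/-- The free components of `c * f = f * c` show that `kill Γ v c` carries the free component of `f`
to a conjugate of itself, so `exists_periodic_finset` applies. -/
theorem exists_cosets {v : V} {f : GraphGroup Γ} (hf : kill Γ v f = 1) (hf1 : f ≠ 1) :
    ∃ Y : Set (GraphGroup Γ ⧸ link Γ v), Y.Nonempty ∧
      restrictTo Y (split Γ v f).left ≠ 1 ∧
      ∀ c, Commute c f → ∀ y ∈ Y, ∃ N > 0, kill Γ v c ^ N • y = y := by
  obtain ⟨Y, hY, h⟩ := exists_periodic_finset (split_left_ne_one hf hf1)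
  refine ⟨Y, ?_, hY, fun c hc y hy => ?_⟩
  · rw [Set.nonempty_iff_ne_empty]
    intro h0
    refine hY ?_
    rw [h0]
    suffices restrictTo (∅ : Set (GraphGroup Γ ⧸ link Γ v)) = 1 from DFunLike.congr_fun this _
    ext x
    simp [restrictTo]
  · have hs := congrArg SemidirectProduct.left (hc.map (split Γ v)).eq
    rw [split_eq_inl hf, mul_left, mul_left, left_inl, right_inl, _root_.map_one, MulAut.one_apply,
      split_right] at hs
    obtain ⟨N, hN, hNy⟩ := h (MulAction.toPerm (kill Γ v c))
      (isConj_iff.2 ⟨(split Γ v c).left, mul_inv_eq_of_eq_mul hs⟩) y hy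
    refine ⟨N, hN, ?_⟩
    have := (map_pow (MulAction.toPermHom (GraphGroup Γ) (GraphGroup Γ ⧸ link Γ v))
      (kill Γ v c) N)
    exact (DFunLike.congr_fun this y).trans hNy

end GraphGroup

/-! ### Unique roots and centralizers of kernel elements -/

namespace GraphGroup

open SemidirectProduct FreeGroup
open scoped commutatorElement

variable {V : Type u} {Γ : SimpleGraph V}

theorem smul_coset_eq_iff {v : V} {g k : GraphGroup Γ} :
    g • (k : GraphGroup Γ ⧸ link Γ v) = k ↔ k⁻¹ * g * k ∈ link Γ v := by
  rw [MulAction.Quotient.smul_coe, eq_comm, QuotientGroup.eq, smul_eq_mul, mul_assoc]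

theorem conj_pow' (g k : GraphGroup Γ) (n : ℕ) : k⁻¹ * g ^ n * k = (k⁻¹ * g * k) ^ n := by
  simpa using (conj_pow (a := k⁻¹) (b := g) (i := n)).symm

/-- Roots are unique among the elements conjugate into a finitely generated special subgroup. -/
theorem eq_of_pow_eq_of_finset (S : Finset V) : ∀ {x y k l : GraphGroup Γ} {n : ℕ},
    retract Γ S x = x → retract Γ S y = y → n ≠ 0 →
    (k⁻¹ * x * k) ^ n = (l⁻¹ * y * l) ^ n → k⁻¹ * x * k = l⁻¹ * y * l := by
  classical
  induction S using Finset.induction_on with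
  | empty =>
    intro x y k l n hx hy _ _
    rw [← hx, ← hy, Finset.coe_empty]
    simp [retract_empty]
  | insert v S hv ih =>
    intro x y k l n hx hy hn h
    have hkS : ∀ z : GraphGroup Γ, retract Γ (insert v S : Finset V) z = z →
        retract Γ S (kill Γ v z) = kill Γ v z := fun z hz => by
      have hs : ({v}ᶜ ∩ (insert v S : Finset V) : Set V) ⊆ S := by
        rintro a ⟨h1, h2⟩
        exact (Finset.mem_insert.1 (Finset.mem_coe.1 h2)).resolve_left h1
      refine retract_eq_of_subset hs ?_
      rw [← retract_retract, retract_comm {v}ᶜ, retract_retract {v}ᶜ, Set.inter_self,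
        retract_comm, hz]
    set X := k⁻¹ * x * k with hX
    set Y := l⁻¹ * y * l with hY
    have hkX : kill Γ v X = (kill Γ v k)⁻¹ * kill Γ v x * kill Γ v k := by simp [hX]
    have hkY : kill Γ v Y = (kill Γ v l)⁻¹ * kill Γ v y * kill Γ v l := by simp [hY]
    have hkill : kill Γ v X = kill Γ v Y := by
      rw [hkX, hkY]
      refine ih (hkS x hx) (hkS y hy) hn ?_
      rw [← hkX, ← hkY, ← _root_.map_pow, ← _root_.map_pow, h]
    by_contra hne
    have hf1 : X⁻¹ * Y ≠ 1 := fun h => hne (inv_mul_eq_one.1 h)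
    have hf : kill Γ v (X⁻¹ * Y) = 1 := by simp [hkill]
    obtain ⟨C, -, hC, hper⟩ := exists_cosets hf hf1
    -- `X ^ n = Y ^ n` commutes with both `X` and `Y`.
    have hcomm : Commute (X ^ n) (X⁻¹ * Y) := by
      refine Commute.mul_right ?_ ?_
      · exact ((Commute.refl X).pow_left n).inv_right
      · rw [h]; exact (Commute.refl Y).pow_left n
    have hfix : kill Γ v X ∈ fixingSubgroup (GraphGroup Γ) C := by
      rw [mem_fixingSubgroup_iff]
      intro c hc
      obtain ⟨N, hN, hNc⟩ := hper _ hcomm c hc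
      induction c using QuotientGroup.induction_on with
      | H m =>
        rw [_root_.map_pow, ← pow_mul, smul_coset_eq_iff, conj_pow', mem_link_iff,
          _root_.map_pow] at hNc
        rw [smul_coset_eq_iff, mem_link_iff]
        have e1 : m⁻¹ * kill Γ v X * m =
            (kill Γ v k * m)⁻¹ * kill Γ v x * (kill Γ v k * m) := by
          rw [hkX]; group
        rw [e1] at hNc ⊢
        simp only [_root_.map_mul _ (_ * _) (_ * _), _root_.map_mul _ (_⁻¹), _root_.map_inv] at hNc ⊢
        -- The induction hypothesis compares a conjugate with its retraction to the link. The
        -- conjugator involves an arbitrary coset representative `m`, hence the statement for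
        -- conjugates by any elements of the group.
        refine ih ?_ (hkS x hx) (Nat.mul_ne_zero hn hN.ne') hNc
        rw [retract_comm, hkS x hx]
    let x' : (fixingSubgroup (GraphGroup Γ) C).comap (kill Γ v) := ⟨X, hfix⟩
    let y' : (fixingSubgroup (GraphGroup Γ) C).comap (kill Γ v) :=
      ⟨Y, by rw [Subgroup.mem_comap, ← hkill]; exact hfix⟩
    have hpow : x' ^ n = y' ^ n := Subtype.ext h
    have := congrArg (cosetHom Γ v C) hpow
    rw [_root_.map_pow, _root_.map_pow] at this
    have hxy := pow_left_injective hn this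
    refine hC ?_
    change cosetHom Γ v C (x'⁻¹ * y') = 1
    rw [_root_.map_mul, _root_.map_inv, hxy, inv_mul_cancel]

/-- Roots are unique in graph groups. -/
theorem eq_of_pow_eq {x y : GraphGroup Γ} {n : ℕ} (hn : n ≠ 0) (h : x ^ n = y ^ n) : x = y := by
  classical
  obtain ⟨S, hS⟩ := exists_finset_retract_eq x
  obtain ⟨T, hT⟩ := exists_finset_retract_eq y
  have := eq_of_pow_eq_of_finset (S ∪ T) (x := x) (y := y) (k := 1) (l := 1)
    (retract_eq_of_subset (Finset.coe_subset.2 Finset.subset_union_left) hS)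
    (retract_eq_of_subset (Finset.coe_subset.2 Finset.subset_union_right) hT) hn (by simpa using h)
  simpa using this

/-- The link is the fixed set of a retraction, so `g` and its retraction are roots of the same
element. -/
theorem mem_link_of_pow_mem {v : V} {g : GraphGroup Γ} {n : ℕ} (hn : n ≠ 0)
    (h : g ^ n ∈ link Γ v) : g ∈ link Γ v := by
  rw [mem_link_iff] at *
  rw [_root_.map_pow] at h
  exact eq_of_pow_eq hn h

/-- The centralizer of a nontrivial element `f` of the kernel of `kill Γ v` maps to a free group
with `f` surviving, and its image under `kill Γ v` is conjugate into the link of `v`. -/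
theorem exists_hom_centralizer {v : V} {f : GraphGroup Γ} (hf : kill Γ v f = 1) (hf1 : f ≠ 1) :
    ∃ θ : Subgroup.centralizer {f} →* CosetFreeGroup Γ v,
      θ ⟨f, Subgroup.mem_centralizer_singleton_iff.2 rfl⟩ ≠ 1 ∧
      ∃ k : GraphGroup Γ, ∀ c, Commute c f → k⁻¹ * kill Γ v c * k ∈ link Γ v := by
  obtain ⟨C, ⟨c₀, hc₀⟩, hC, hper⟩ := exists_cosets hf hf1
  have hfix : ∀ c, Commute c f → ∀ y ∈ C, kill Γ v c • y = y := by
    intro c hc y hy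
    obtain ⟨N, hN, hNy⟩ := hper c hc y hy
    induction y using QuotientGroup.induction_on with
    | H m =>
      rw [smul_coset_eq_iff, conj_pow'] at hNy
      exact smul_coset_eq_iff.2 (mem_link_of_pow_mem hN.ne' hNy)
  have hle : Subgroup.centralizer {f} ≤
      (fixingSubgroup (GraphGroup Γ) C).comap (kill Γ v) := fun c hc =>
    (mem_fixingSubgroup_iff _).2 (hfix c (Subgroup.mem_centralizer_singleton_iff.1 hc))
  refine ⟨(cosetHom Γ v C).comp (Subgroup.inclusion hle), hC, ?_⟩
  induction c₀ using QuotientGroup.induction_on with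
  | H k => exact ⟨k, fun c hc => smul_coset_eq_iff.1 (hfix c hc _ hc₀)⟩

/-- Nontrivial commuting elements of the kernel of `kill Γ v` have a common nontrivial power. -/
theorem exists_zpow_eq_zpow {v : V} {f g : GraphGroup Γ} (hf : kill Γ v f = 1) (hf1 : f ≠ 1)
    (hg : kill Γ v g = 1) (hg1 : g ≠ 1) (h : Commute f g) :
    ∃ m n : ℤ, m ≠ 0 ∧ n ≠ 0 ∧ f ^ m = g ^ n := by
  have hc : Commute (split Γ v f).left (split Γ v g).left := by
    have := (h.map (split Γ v)).eq
    rw [split_eq_inl hf, split_eq_inl hg, ← _root_.map_mul, ← _root_.map_mul] at this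
    exact inl_injective this
  obtain ⟨m, n, hm, hn, e⟩ := FreeGroup.exists_zpow_eq_zpow_of_commute
    (split_left_ne_one hf hf1) (split_left_ne_one hg hg1) hc
  refine ⟨m, n, hm, hn, split_injective v ?_⟩
  rw [map_zpow, map_zpow, split_eq_inl hf, split_eq_inl hg, ← map_zpow, ← map_zpow, e]

/-- If two noncommuting pairs commute with each other, then killing a vertex keeps at least one of
the pairs noncommuting. -/
theorem not_commute_kill {v : V} {a b c d : GraphGroup Γ} (hab : ¬ Commute a b)
    (hcd : ¬ Commute c d) (hac : Commute a c) (had : Commute a d) (hbc : Commute b c)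
    (hbd : Commute b d) (h₁ : Commute (kill Γ v a) (kill Γ v b)) :
    ¬ Commute (kill Γ v c) (kill Γ v d) := by
  intro h₂
  have hf : kill Γ v ⁅a, b⁆ = 1 := by
    rw [map_commutatorElement]; exact commutatorElement_eq_one_iff_commute.2 h₁
  have hg : kill Γ v ⁅c, d⁆ = 1 := by
    rw [map_commutatorElement]; exact commutatorElement_eq_one_iff_commute.2 h₂
  have hf1 : ⁅a, b⁆ ≠ 1 := fun h => hab (commutatorElement_eq_one_iff_commute.1 h)
  have hg1 : ⁅c, d⁆ ≠ 1 := fun h => hcd (commutatorElement_eq_one_iff_commute.1 h)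
  have comm : ∀ x, Commute x c → Commute x d → Commute x ⁅c, d⁆ := fun x h h' => by
    rw [commutatorElement_def]
    exact ((h.mul_right h').mul_right h.inv_right).mul_right h'.inv_right
  have ha := comm a hac had
  have hb := comm b hbc hbd
  have hfg : Commute ⁅a, b⁆ ⁅c, d⁆ := by
    rw [commutatorElement_def a b]
    exact ((ha.mul_left hb).mul_left ha.inv_left).mul_left hb.inv_left
  obtain ⟨m, n, hm, hn, e⟩ := exists_zpow_eq_zpow hf hf1 hg hg1 hfg
  obtain ⟨θ, hθ, -⟩ := exists_hom_centralizer hg hg1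
  let a' : Subgroup.centralizer {⁅c, d⁆} := ⟨a, Subgroup.mem_centralizer_singleton_iff.2 ha⟩
  let b' : Subgroup.centralizer {⁅c, d⁆} := ⟨b, Subgroup.mem_centralizer_singleton_iff.2 hb⟩
  let g' : Subgroup.centralizer {⁅c, d⁆} := ⟨_, Subgroup.mem_centralizer_singleton_iff.2 rfl⟩
  have ha' : Commute a' g' := Subtype.ext ha
  have hb' : Commute b' g' := Subtype.ext hb
  -- Both images commute with `θ g' ≠ 1`, and commuting is transitive there. A common power of the
  -- two commutators then makes `θ g'` torsion.
  have hθab : θ ⁅a', b'⁆ = 1 := by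
    rw [map_commutatorElement]
    exact commutatorElement_eq_one_iff_commute.2
      (FreeGroup.commute_of_commute hθ (ha'.map θ) (hb'.map θ))
  have e' : ⁅a', b'⁆ ^ m = g' ^ n := Subtype.ext e
  have := congrArg θ e'
  rw [map_zpow, map_zpow, hθab, one_zpow, eq_comm] at this
  exact hθ ((IsMulTorsionFree.zpow_eq_one_iff_left hn).1 this)

end GraphGroup

/-! ### Finding the induced four-cycle -/

namespace GraphGroup

open scoped commutatorElement SimpleGraph

variable {V : Type u} {Γ : SimpleGraph V}

theorem cycleGraph_four_isIndContained {p q r s : V} (hpr : p ≠ r) (hpr' : ¬ Γ.Adj p r)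
    (hqs : q ≠ s) (hqs' : ¬ Γ.Adj q s) (hpq : Γ.Adj p q) (hqr : Γ.Adj q r) (hrs : Γ.Adj r s)
    (hsp : Γ.Adj s p) : SimpleGraph.cycleGraph 4 ⊴ Γ := by
  refine ⟨⟨⟨![p, q, r, s], ?_⟩, ?_⟩⟩
  · intro i j h
    fin_cases i <;> fin_cases j <;>
      simp_all [hpq.ne, hqr.ne, hrs.ne, hsp.ne, hpq.ne', hqr.ne', hrs.ne', hsp.ne', hpr.symm,
        hqs.symm]
  · intro i j
    have hpr'' : ¬ Γ.Adj r p := fun h => hpr' h.symm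
    have hqs'' : ¬ Γ.Adj s q := fun h => hqs' h.symm
    change Γ.Adj (![p, q, r, s] i) (![p, q, r, s] j) ↔ _
    rw [SimpleGraph.cycleGraph_adj]
    fin_cases i <;> fin_cases j <;> simp [hpr', hpr'', hqs', hqs'', hpq, hpq.symm, hqr, hqr.symm,
        hrs, hrs.symm, hsp, hsp.symm] <;> decide

theorem commute_conj_iff {G : Type*} [Group G] {k x y : G} :
    Commute (k⁻¹ * x * k) (k⁻¹ * y * k) ↔ Commute x y := by
  simpa using Commute.conj_iff (a := x) (b := y) k⁻¹

theorem commute_retract_of_clique {S : Set V} (hS : Γ.IsClique S) (g h : GraphGroup Γ) :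
    Commute (retract Γ S g) (retract Γ S h) := by
  refine commute_of_forall_mem (fun a ha => (commute_of_forall_mem (fun b hb => ?_) g).symm) h
  rcases eq_or_ne a b with rfl | hab
  · exact Commute.refl _
  · exact of_commute (hS ha hb hab)

theorem commute_of_retract {S : Set V} {v : V} (hv : ∀ s ∈ S, s ≠ v → Γ.Adj v s)
    (g : GraphGroup Γ) : Commute (of Γ v) (retract Γ S g) := by
  refine commute_of_forall_mem (fun a ha => ?_) g
  rcases eq_or_ne a v with rfl | hav
  · exact Commute.refl _
  · exact of_commute (hv a ha hav)

/-- If `v` is adjacent to all other vertices of `S`, it splits off as a cyclic factor. -/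
theorem exists_eq_zpow_mul_kill {S : Set V} {v : V} (hv : ∀ s ∈ S, s ≠ v → Γ.Adj v s)
    (g : GraphGroup Γ) : ∃ n : ℤ, retract Γ S g = of Γ v ^ n * kill Γ v (retract Γ S g) := by
  have hcomm : ∀ x, Commute (of Γ v) (kill Γ v (retract Γ S x)) := fun x => by
    rw [retract_comm]; exact commute_of_retract hv _
  induction g using GraphGroup.induction with
  | one => exact ⟨0, by simp⟩
  | gen a =>
    by_cases ha : a ∈ S
    · rw [retract_of_mem ha]
      rcases eq_or_ne a v with rfl | hav
      · exact ⟨1, by simp [kill, retract_of_notMem]⟩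
      · exact ⟨0, by simp [kill, retract_of_mem, hav]⟩
    · exact ⟨0, by simp [retract_of_notMem ha]⟩
  | mul x y hx hy =>
    obtain ⟨m, hm⟩ := hx
    obtain ⟨n, hn⟩ := hy
    refine ⟨m + n, ?_⟩
    have := ((hcomm x).zpow_left n).eq
    rw [_root_.map_mul, _root_.map_mul, zpow_add, mul_assoc, ← mul_assoc (of Γ v ^ n), this,
      mul_assoc, ← hn, ← mul_assoc, ← hm]
  | inv x hx =>
    obtain ⟨m, hm⟩ := hx
    refine ⟨-m, ?_⟩
    have := ((hcomm x).zpow_left m).eq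
    rw [_root_.map_inv, _root_.map_inv, zpow_neg, ← mul_inv_rev, ← this, ← hm]

theorem commute_of_commute_kill {S : Set V} {v : V} (hv : ∀ s ∈ S, s ≠ v → Γ.Adj v s)
    {g h : GraphGroup Γ} (hg : retract Γ S g = g) (hh : retract Γ S h = h)
    (hgh : Commute (kill Γ v g) (kill Γ v h)) : Commute g h := by
  obtain ⟨m, hm⟩ := exists_eq_zpow_mul_kill hv g
  obtain ⟨n, hn⟩ := exists_eq_zpow_mul_kill hv h
  rw [hg] at hm
  rw [hh] at hn
  have key : ∀ x, retract Γ S x = x → Commute (of Γ v) (kill Γ v x) := fun x hx => by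
    rw [← hx, retract_comm]; exact commute_of_retract hv _
  have h1 := (key g hg).zpow_left n
  have h2 := (key h hh).zpow_left m
  rw [hm, hn]
  exact ((Commute.zpow_zpow_self _ m n).mul_right h2).mul_left (h1.symm.mul_right hgh)

theorem retract_erase [DecidableEq V] (S : Finset V) (v : V) (g : GraphGroup Γ) :
    retract Γ (S.erase v : Finset V) g = kill Γ v (retract Γ S g) := by
  rw [retract_retract, Finset.coe_erase, Set.sdiff_eq, Set.inter_comm]

theorem isIndContained_of_not_commute_kill {S : Finset V} {a b c d : GraphGroup Γ}
    (ha : retract Γ S a = a) (hb : retract Γ S b = b)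
    (hc : retract Γ S c = c) (hd : retract Γ S d = d)
    (hcd : ¬ Commute c d) (hac : Commute a c) (had : Commute a d) (hbc : Commute b c)
    (hbd : Commute b d)
    (hS : ∀ w ∈ S, Commute (kill Γ w a) (kill Γ w b) ∨ Commute (kill Γ w c) (kill Γ w d))
    {v : V} (hv : v ∈ S) (hva : ¬ Commute (kill Γ v a) (kill Γ v b)) :
    SimpleGraph.cycleGraph 4 ⊴ Γ := by
  classical
  obtain ⟨T, ⟨hvT, hT⟩, hmin⟩ := exists_minimal_of_wellFoundedLT
    (fun T : Finset V => v ∉ T ∧ ¬ Commute (retract Γ T a) (retract Γ T b))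
    ⟨S.erase v, by simp, by rwa [retract_erase, retract_erase, ha, hb]⟩
  -- Killing `w ∉ T` keeps `a, b` noncommuting, so it makes `c, d` commute, and one `k` conjugates
  -- `kill Γ w a` and `kill Γ w b` into the link of `w`. If `t` were outside this link, the
  -- conjugated retractions to `T` would factor through `T.erase t`, where `a, b` commute by
  -- minimality.
  have hjoin : ∀ w ∈ S, w ∉ T → ∀ t ∈ T, Γ.Adj w t := by
    intro w hw hwT t ht
    by_contra hadj
    have hTw : ∀ x, retract Γ T (kill Γ w x) = retract Γ T x := fun x => by
      rw [retract_retract, Set.inter_eq_left.2]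
      rintro s hs rfl
      exact hwT hs
    have hwc : Commute (kill Γ w c) (kill Γ w d) := (hS w hw).resolve_left fun h => hT <| by
      simpa only [hTw] using h.map (retract Γ T)
    have hf : kill Γ w ⁅c, d⁆ = 1 := by
      rw [map_commutatorElement]; exact commutatorElement_eq_one_iff_commute.2 hwc
    obtain ⟨-, -, k, hk⟩ := exists_hom_centralizer hf
      fun h => hcd (commutatorElement_eq_one_iff_commute.1 h)
    have comm : ∀ x, Commute x c → Commute x d → Commute x ⁅c, d⁆ := fun x h h' => by
      rw [commutatorElement_def]
      exact ((h.mul_right h').mul_right h.inv_right).mul_right h'.inv_right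
    have hte : Commute (retract Γ (T.erase t : Finset V) a) (retract Γ (T.erase t : Finset V) b) := by
      by_contra hne
      have := hmin ⟨fun h => hvT (Finset.mem_of_mem_erase h), hne⟩ (Finset.erase_subset t T)
      exact Finset.notMem_erase t T (this ht)
    have hTe : ((T.erase t : Finset V) : Set V) ∩ {w}ᶜ = (T.erase t : Finset V) := by
      rw [Set.inter_eq_left]
      rintro s hs rfl
      exact hwT (Finset.mem_of_mem_erase hs)
    have hN : (T : Set V) ∩ Γ.neighborSet w = Γ.neighborSet w ∩ (T.erase t : Finset V) := by
      ext s
      simp only [Set.mem_inter_iff, Finset.mem_coe, SimpleGraph.mem_neighborSet, Finset.mem_erase]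
      constructor
      · rintro ⟨h1, h2⟩
        exact ⟨h2, fun h => hadj (h ▸ h2), h1⟩
      · rintro ⟨h1, -, h2⟩
        exact ⟨h2, h1⟩
    have hx : ∀ x, Commute x c → Commute x d →
        (retract Γ T k)⁻¹ * retract Γ T x * retract Γ T k =
          retract Γ (Γ.neighborSet w) ((retract Γ (T.erase t : Finset V) k)⁻¹ *
            retract Γ (T.erase t : Finset V) x * retract Γ (T.erase t : Finset V) k) := by
      intro x h h'
      have h1 := mem_link_iff.1 (hk x (comm x h h'))
      calc _ = retract Γ T (k⁻¹ * kill Γ w x * k) := by simp only [_root_.map_mul, _root_.map_inv, hTw]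
        _ = retract Γ (Γ.neighborSet w) (retract Γ (T.erase t : Finset V)
              (k⁻¹ * kill Γ w x * k)) := by
            rw [← h1, retract_retract, hN, ← retract_retract, h1]
        _ = _ := by simp only [_root_.map_mul, _root_.map_inv, retract_retract, hTe]
    refine hT (commute_conj_iff (k := retract Γ T k).1 ?_)
    rw [hx a hac had, hx b hbc hbd]
    exact (commute_conj_iff.2 hte).map _
  have hTpair : ∃ p ∈ T, ∃ r ∈ T, p ≠ r ∧ ¬ Γ.Adj p r := by
    by_contra! h
    exact hT (commute_retract_of_clique (fun p hp r hr hpr => h p hp r hr hpr) a b)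
  -- Otherwise `v` is a central factor of the subgroup on `S`, and `c, d`, which commute once `v` is
  -- killed, would already commute.
  have hSpair : ∃ q ∈ S, q ∉ T ∧ q ≠ v ∧ ¬ Γ.Adj v q := by
    by_contra! h
    refine hcd (commute_of_commute_kill (v := v) (fun s hs hsv => ?_) hc hd
      ((hS v hv).resolve_left hva))
    by_cases hsT : s ∈ T
    · exact hjoin v hv hvT s hsT
    · exact h s hs hsT hsv
  obtain ⟨p, hp, r, hr, hpr, hpr'⟩ := hTpair
  obtain ⟨q, hq, hqT, hqv, hqv'⟩ := hSpair
  exact cycleGraph_four_isIndContained hpr hpr' hqv.symm hqv' (hjoin v hv hvT p hp).symm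
    (hjoin v hv hvT r hr) (hjoin q hq hqT r hr).symm (hjoin q hq hqT p hp)

theorem isIndContained_of_finset (S : Finset V) : ∀ {a b c d : GraphGroup Γ},
    retract Γ S a = a → retract Γ S b = b → retract Γ S c = c → retract Γ S d = d →
    ¬ Commute a b → ¬ Commute c d → Commute a c → Commute a d → Commute b c → Commute b d →
    SimpleGraph.cycleGraph 4 ⊴ Γ := by
  classical
  induction S using Finset.strongInduction with
  | H S ih =>
    intro a b c d ha hb hc hd hab hcd hac had hbc hbd
    by_contra hcon
    have hS : ∀ w ∈ S, Commute (kill Γ w a) (kill Γ w b) ∨ Commute (kill Γ w c) (kill Γ w d) := by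
      intro w hw
      by_contra! h
      have he : ∀ x, retract Γ S x = x →
          retract Γ (S.erase w : Finset V) (kill Γ w x) = kill Γ w x := fun x hx => by
        rw [retract_erase, retract_comm (S : Set V), hx, retract_retract, Set.inter_self]
      exact hcon (ih (S.erase w) (Finset.erase_ssubset hw) (he a ha) (he b hb) (he c hc) (he d hd)
        h.1 h.2 (hac.map _) (had.map _) (hbc.map _) (hbd.map _))
    have hne : S.Nonempty := by
      rw [Finset.nonempty_iff_ne_empty]
      rintro rfl
      rw [Finset.coe_empty, retract_empty] at ha
      exact hab (ha ▸ Commute.one_left b)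
    obtain ⟨v, hv⟩ := hne
    have h1 : Commute (kill Γ v a) (kill Γ v b) := by
      by_contra h
      exact hcon (isIndContained_of_not_commute_kill ha hb hc hd hcd hac had hbc hbd hS hv h)
    -- The hypotheses are symmetric under exchanging the two pairs.
    have h2 : Commute (kill Γ v c) (kill Γ v d) := by
      by_contra h
      exact hcon (isIndContained_of_not_commute_kill hc hd ha hb hab hac.symm hbc.symm had.symm
        hbd.symm (fun w hw => (hS w hw).symm) hv h)
    exact not_commute_kill hab hcd hac had hbc hbd h1 h2

/-- If two noncommuting pairs in a graph group commute with each other, then the graph has an induced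
four-cycle. -/
theorem isIndContained_of_commute {a b c d : GraphGroup Γ} (hab : ¬ Commute a b)
    (hcd : ¬ Commute c d) (hac : Commute a c) (had : Commute a d) (hbc : Commute b c)
    (hbd : Commute b d) : SimpleGraph.cycleGraph 4 ⊴ Γ := by
  classical
  obtain ⟨A, hA⟩ := exists_finset_retract_eq a
  obtain ⟨B, hB⟩ := exists_finset_retract_eq b
  obtain ⟨C, hC⟩ := exists_finset_retract_eq c
  obtain ⟨D, hD⟩ := exists_finset_retract_eq d
  refine isIndContained_of_finset (A ∪ B ∪ C ∪ D) (retract_eq_of_subset ?_ hA)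
    (retract_eq_of_subset ?_ hB) (retract_eq_of_subset ?_ hC) (retract_eq_of_subset ?_ hD)
    hab hcd hac had hbc hbd <;>
  · intro x hx
    simp only [Finset.coe_union, Set.mem_union]
    tauto

/-- A product of at least two noncommutative monoids has no injective homomorphism to the graph
group of a graph without induced four-cycles. -/
theorem not_injective_of_pi (hΓ : ¬ SimpleGraph.cycleGraph 4 ⊴ Γ) {ι : Type w} [Nontrivial ι]
    {M : ι → Type v} [∀ i, Monoid (M i)] (hM : ∀ i, IsNonAbelian (M i))
    (φ : (∀ i, M i) →* GraphGroup Γ) : ¬ Function.Injective φ := by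
  classical
  intro hφ
  obtain ⟨i, j, hij⟩ := exists_pair_ne ι
  obtain ⟨a, b, hab⟩ := hM i
  obtain ⟨c, d, hcd⟩ := hM j
  have hne : ∀ (k : ι) (x y : M k), x * y ≠ y * x →
      ¬ Commute (φ (Pi.mulSingle k x)) (φ (Pi.mulSingle k y)) := by
    intro k x y hxy h
    have h' := h.eq
    rw [← map_mul, ← map_mul, hφ.eq_iff, ← Pi.mulSingle_mul, ← Pi.mulSingle_mul] at h'
    exact hxy (Pi.mulSingle_injective k h')
  have hc : ∀ (x : M i) (y : M j), Commute (φ (Pi.mulSingle i x)) (φ (Pi.mulSingle j y)) :=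
    fun x y => (Pi.mulSingle_commute hij x y).map φ
  exact hΓ (isIndContained_of_commute (hne i a b hab) (hne j c d hcd) (hc a c) (hc a d) (hc b c)
    (hc b d))

end GraphGroup

theorem mainTheorem2 {V : Type u} (Γ : SimpleGraph V)
    (hΓ : ¬ SimpleGraph.IsIndContained (SimpleGraph.cycleGraph 4) Γ) :
    (∀ (ι : Type w) [Nontrivial ι] (H : ι → Type v) [∀ i, Group (H i)],
      (∀ i, IsNonAbelian (H i)) →
        ¬ ∃ S : Subgroup (GraphGroup Γ), Nonempty (S ≃* ∀ i, H i)) ∧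
    (∀ (ι : Type w) [Nontrivial ι] (M : ι → Type v) [∀ i, Monoid (M i)],
      (∀ i, IsNonAbelian (M i)) →
        ¬ ∃ S : Submonoid (GraphGroup Γ), Nonempty (S ≃* ∀ i, M i)) := by
  constructor
  · rintro ι _ H _ hH ⟨S, ⟨e⟩⟩
    exact GraphGroup.not_injective_of_pi hΓ hH (S.subtype.comp e.symm.toMonoidHom)
      (S.subtype_injective.comp e.symm.injective)
  · rintro ι _ M _ hM ⟨S, ⟨e⟩⟩
    exact GraphGroup.not_injective_of_pi hΓ hM (S.subtype.comp e.symm.toMonoidHom)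
      (Subtype.val_injective.comp e.symm.injective)
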